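/- Let $X$ be a compact Hausdorff space with the $\pi$-FNS property: $X$ has a $\pi$-base $\mathcal B$ (a family of nonempty open sets such that every nonempty open subset of $X$ contains a member of $\mathcal B$) for which there is a map $s\colon\mathcal B\to[\mathcal B]^{<\omega}$ (the finite subsets of $\mathcal B$) such that for all disjoint $U,V\in\mathcal B$ there are disjoint $W_U,W_V\in s(U)\cap s(V)$ with $U\subseteq W_U$ and $V\subseteq W_V$. Then $X$ is skeletally generated; that is, there are a nonempty directed partially ordered set $\Sigma$ and an inverse system $\{X_\sigma,p^{\sigma'}_\sigma,\Sigma\}$ with continuous bonding maps such that $X$ is homeomorphic to $\varprojlim\{X_\sigma,p^{\sigma'}_\sigma,\Sigma\}$ and 1. every $X_\sigma$ is a compact metrizable space; 2. for $\sigma\le\sigma'$ the map $p^{\sigma'}_\sigma\colon X_{\sigma'}\to X_\sigma$ is surjective and skeletal, i.e. $\operatorname{int}\operatorname{cl}p^{\sigma'}_\sigma(U)\neq\emptyset$ for every nonempty open $U\subseteq X_{\sigma'}$; 3. $\Sigma$ is $\sigma$-complete: every sequence $\sigma_0\le\sigma_1\le\cdots$ in $\Sigma$ has a least upper bound in $\Sigma$;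 4. the system is continuous: if $\sigma=\sup_n\sigma_n$ for a sequence $\sigma_0\le\sigma_1\le\cdots$ in $\Sigma$, then the canonical map $X_\sigma\to\varprojlim\{X_{\sigma_n},p^{\sigma_{n+1}}_{\sigma_n},\omega\}$, $x\mapsto(p^{\sigma}_{\sigma_n}(x))_n$, is a homeomorphism. -/

import Mathlib

/-- A π-base of `X`: a family of nonempty open sets such that every nonempty open set
contains a member of the family. -/
def IsPiBase {X : Type*} [TopologicalSpace X] (B : Set (Set X)) : Prop :=
  (∀ U ∈ B, IsOpen U ∧ U.Nonempty) ∧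
    ∀ V : Set X, IsOpen V → V.Nonempty → ∃ U ∈ B, U ⊆ V

/-- The FNS property of a family `B` of sets: there is a map `s` from `B` to the finite subsets
of `B` such that any two disjoint members `U`, `V` of `B` are contained in disjoint
members `WU`, `WV` of `s U ∩ s V`. -/
def HasFNS {X : Type*} (B : Set (Set X)) : Prop :=
  ∃ s : B → Finset B, ∀ U V : B, Disjoint (U : Set X) (V : Set X) →
    ∃ WU WV : B, (WU ∈ s U ∧ WU ∈ s V) ∧ (WV ∈ s U ∧ WV ∈ s V) ∧
      Disjoint (WU : Set X) (WV : Set X) ∧ (U : Set X) ⊆ WU ∧ (V : Set X) ⊆ WV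

/-- The π-FNS property of a space: some π-base has the FNS property. -/
def PiFNS (X : Type*) [TopologicalSpace X] : Prop :=
  ∃ B : Set (Set X), IsPiBase B ∧ HasFNS B

/-- A map is skeletal if the closure of the image of every nonempty open set has nonempty
interior. -/
def IsSkeletal {X Y : Type*} [TopologicalSpace X] [TopologicalSpace Y] (f : X → Y) : Prop :=
  ∀ U : Set X, IsOpen U → U.Nonempty → (interior (closure (f '' U))).Nonempty

/-- The limit of an inverse system: the set of compatible threads in the product. As a type it
carries the subspace topology of the product topology. -/
def invLimit {ι : Type*} [Preorder ι] {F : ι → Type*}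
    (p : ∀ ⦃i j : ι⦄, i ≤ j → F j → F i) : Set (∀ i, F i) :=
  {x | ∀ (i j : ι) (h : i ≤ j), p h (x j) = x i}

/-- The canonical map from `F t`, where `t` is an upper bound of an increasing sequence `a`,
to the limit of the restriction of the inverse system to `a`; its coordinates are the bonding
maps `F t → F (a n)`. -/
def toSeqLimit {ι : Type*} [Preorder ι] {F : ι → Type*}
    (p : ∀ ⦃i j : ι⦄, i ≤ j → F j → F i) (hp : InverseSystem p)
    (a : ℕ → ι) (ha : Monotone a) (t : ι) (ht : t ∈ upperBounds (Set.range a)) (x : F t) :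
    invLimit (F := fun n => F (a n)) (fun _ _ h => p (ha h)) :=
  ⟨fun n => p (ht ⟨n, rfl⟩) x, fun _ m h => hp.map_map (ha h) (ht ⟨m, rfl⟩) x⟩

/-- A partially ordered set in which every increasing sequence has a least upper bound. -/
def IsSigmaComplete (ι : Type*) [PartialOrder ι] : Prop :=
  ∀ a : ℕ → ι, Monotone a → ∃ t, IsLUB (Set.range a) t

/-- An inverse system is continuous (along increasing sequences) if, whenever `t` is the supremum
of an increasing sequence `a`, the canonical map from `F t` to the limit of the
inverse sequence `F (a n)` is a homeomorphism. -/
def IsContinuousSystem {ι : Type*} [PartialOrder ι] {F : ι → Type*} [∀ i, TopologicalSpace (F i)]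
    (p : ∀ ⦃i j : ι⦄, i ≤ j → F j → F i) (hp : InverseSystem p) : Prop :=
  ∀ (a : ℕ → ι) (ha : Monotone a) (t : ι) (ht : IsLUB (Set.range a) t),
    IsHomeomorph (toSeqLimit p hp a ha t ht.1)

/-- A space is skeletally generated if it is homeomorphic to the limit of a continuous
inverse system of compact metrizable spaces, indexed by a nonempty σ-complete directed set,
with continuous skeletal surjective bonding maps. -/
def SkeletallyGenerated.{u} (X : Type u) [TopologicalSpace X] : Prop :=
  ∃ (ι : Type u) (_ : PartialOrder ι) (F : ι → Type u) (_ : ∀ i, TopologicalSpace (F i))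
    (p : ∀ ⦃i j : ι⦄, i ≤ j → F j → F i) (hp : InverseSystem p),
    Nonempty ι ∧ IsDirectedOrder ι ∧ IsSigmaComplete ι ∧
    (∀ i, CompactSpace (F i) ∧ TopologicalSpace.MetrizableSpace (F i)) ∧
    (∀ ⦃i j : ι⦄ (h : i ≤ j),
      Continuous (p h) ∧ Function.Surjective (p h) ∧ IsSkeletal (p h)) ∧
    IsContinuousSystem p hp ∧
    Nonempty (X ≃ₜ invLimit p)

/-! Index the system by countable sets `C` of members of `B` and real continuous functions on `X`,
closed under a suitable finitary operation; `X_C` is the image of `X` under evaluation at the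
functions of `C`. Such sets are cofinal among countable sets and closed under unions of increasing
sequences. With compactness and Urysohn functions this gives everything except skeletality.

Skeletality is carried by `IsSkeletalFamily.isSkeletal_evalMap`. For `V ∈ B`, the finitely many sets
of `s V` that lie in `C` and contain `V` have nonempty intersection, so closure puts some `W ∈ C`
inside it. By FNS every `U ∈ C` with `U ⊆ W` meets `V`, so the image of `V` is dense in a nonempty
open set given by a function of `C` supported in `W`. -/

/-! ### Countable sets closed under a finitary operation -/

section FinitaryClosure

variable {T : Type*}

/-- A set is closed under the set-valued finitary operation `Φ`. -/
def IsClosedUnder (Φ : Finset T → Set T) (C : Set T) : Prop :=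
  ∀ A : Finset T, (A : Set T) ⊆ C → Φ A ⊆ C

/-- A finite subset of an increasing union already lies in one stage. This serves both the
closing-off construction and suprema of sequences. -/
theorem IsClosedUnder.iUnion_of_monotone {Φ : Finset T → Set T} {a : ℕ → Set T} (ha : Monotone a)
    (h : ∀ n, ∀ A : Finset T, (A : Set T) ⊆ a n → Φ A ⊆ a (n + 1)) :
    IsClosedUnder Φ (⋃ n, a n) := by
  intro A hA
  obtain ⟨n, hn⟩ := ha.directed_le.exists_mem_subset_of_finset_subset_biUnion hA
  exact (h n A hn).trans (Set.subset_iUnion a (n + 1))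

/-- Every countable set is contained in a countable set closed under a given finitary operation
with countable values. -/
theorem exists_countable_isClosedUnder {Φ : Finset T → Set T} (hΦ : ∀ A, (Φ A).Countable)
    {D : Set T} (hD : D.Countable) : ∃ C, D ⊆ C ∧ C.Countable ∧ IsClosedUnder Φ C := by
  let step : Set T → Set T := fun E => E ∪ ⋃ A ∈ {A : Finset T | (A : Set T) ⊆ E}, Φ A
  have hstep : ∀ E, E.Countable → (step E).Countable := by
    intro E hE
    have hfin : {A : Finset T | (A : Set T) ⊆ E}.Countable :=
      ((Set.countable_ofPred_finite_subset hE).preimage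
        (f := fun A : Finset T => (A : Set T)) Finset.coe_injective).mono
        fun A hA => And.intro A.finite_toSet hA
    exact hE.union (hfin.biUnion fun A _ => hΦ A)
  let a : ℕ → Set T := fun n => step^[n] D
  have ha : ∀ n, a (n + 1) = step (a n) := fun n => Function.iterate_succ_apply' step n D
  have hmono : Monotone a := monotone_nat_of_le_succ fun n => by
    rw [ha]; exact Set.subset_union_left
  refine ⟨⋃ n, a n, Set.subset_iUnion a 0, Set.countable_iUnion fun n => ?_,
    IsClosedUnder.iUnion_of_monotone hmono fun n A hA => ?_⟩
  · induction n with
    | zero => exact hD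
    | succ n ih => rw [ha]; exact hstep _ ih
  · rw [ha]
    exact (Set.subset_biUnion_of_mem (u := Φ) (x := A) hA).trans Set.subset_union_right

/-- The countable sets closed under `Φ`, ordered by inclusion. -/
abbrev CountableClosed (Φ : Finset T → Set T) : Type _ :=
  {C : Set T // C.Countable ∧ IsClosedUnder Φ C}

namespace CountableClosed

variable {Φ : Finset T → Set T}

theorem exists_superset (hΦ : ∀ A, (Φ A).Countable) {D : Set T} (hD : D.Countable) :
    ∃ C : CountableClosed Φ, D ⊆ C.1 :=
  let ⟨C, hDC, hC⟩ := exists_countable_isClosedUnder hΦ hD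
  ⟨⟨C, hC⟩, hDC⟩

theorem isDirectedOrder (hΦ : ∀ A, (Φ A).Countable) : IsDirectedOrder (CountableClosed Φ) :=
  ⟨fun C D =>
    let ⟨E, hE⟩ := exists_superset hΦ (C.2.1.union D.2.1)
    ⟨E, Set.subset_union_left.trans hE, Set.subset_union_right.trans hE⟩⟩

theorem exists_isLUB {a : ℕ → CountableClosed Φ} (ha : Monotone a) :
    ∃ t : CountableClosed Φ, t.1 = ⋃ n, (a n).1 ∧ IsLUB (Set.range a) t := by
  refine ⟨⟨⋃ n, (a n).1, Set.countable_iUnion fun n => (a n).2.1,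
    IsClosedUnder.iUnion_of_monotone (fun _ _ h => ha h) fun n A hA =>
      ((a n).2.2 A hA).trans (ha n.le_succ)⟩, rfl, ?_, fun u hu => ?_⟩
  · rintro _ ⟨n, rfl⟩
    exact Set.subset_iUnion (fun n => (a n).1) n
  · exact Set.iUnion_subset fun n => hu ⟨n, rfl⟩

theorem isSigmaComplete : IsSigmaComplete (CountableClosed Φ) := fun _ ha =>
  let ⟨t, _, ht⟩ := exists_isLUB ha
  ⟨t, ht⟩

theorem coe_eq_iUnion_of_isLUB {a : ℕ → CountableClosed Φ} (ha : Monotone a)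
    {t : CountableClosed Φ} (ht : IsLUB (Set.range a) t) : t.1 = ⋃ n, (a n).1 := by
  obtain ⟨u, hu, hlub⟩ := exists_isLUB ha
  rw [ht.unique hlub, hu]

end CountableClosed

end FinitaryClosure

/-! ### Metrizable images of `X` under countably many functions -/

section Evaluation

variable {X : Type*} [TopologicalSpace X]

/-- The image of `X` under the evaluation map into the product of lines indexed by a set `S` of
continuous functions. -/
def EvalImage (S : Set C(X, ℝ)) : Set (S → ℝ) :=
  Set.range fun (x : X) (f : S) => f.1 x

/-- The evaluation map from `X` onto its image. -/
def evalMap (S : Set C(X, ℝ)) (x : X) : EvalImage S :=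
  ⟨fun f => f.1 x, x, rfl⟩

/-- The projection between evaluation images that forgets coordinates. -/
def evalRestrict {S S' : Set C(X, ℝ)} (h : S ⊆ S') (y : EvalImage S') : EvalImage S :=
  ⟨fun f => y.1 ⟨f.1, h f.2⟩, by
    obtain ⟨x, hx⟩ := y.2
    exact ⟨x, by rw [← hx]⟩⟩

theorem continuous_evalMap (S : Set C(X, ℝ)) : Continuous (evalMap S) :=
  Continuous.subtype_mk (continuous_pi fun f => f.1.continuous) _

theorem surjective_evalMap (S : Set C(X, ℝ)) : Function.Surjective (evalMap S) := by
  rintro ⟨_, x, rfl⟩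
  exact ⟨x, rfl⟩

theorem continuous_evalRestrict {S S' : Set C(X, ℝ)} (h : S ⊆ S') :
    Continuous (evalRestrict h) :=
  Continuous.subtype_mk
    (continuous_pi fun f => (continuous_apply (⟨f.1, h f.2⟩ : S')).comp continuous_subtype_val) _

theorem surjective_evalRestrict {S S' : Set C(X, ℝ)} (h : S ⊆ S') :
    Function.Surjective (evalRestrict h) :=
  Function.Surjective.of_comp (g := evalMap S') (surjective_evalMap S)

theorem compactSpace_evalImage [CompactSpace X] (S : Set C(X, ℝ)) : CompactSpace (EvalImage S) :=
  (surjective_evalMap S).compactSpace (continuous_evalMap S)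

theorem metrizableSpace_evalImage {S : Set C(X, ℝ)} (hS : S.Countable) :
    TopologicalSpace.MetrizableSpace (EvalImage S) :=
  have := hS.to_subtype
  inferInstance

/-- A compatible family of points of evaluation images, indexed by a directed set, comes from a
point of a compact space. -/
theorem exists_forall_evalMap_eq [CompactSpace X] {J : Type*} [Preorder J] [IsDirectedOrder J]
    [Nonempty J] {S : J → Set C(X, ℝ)} (hS : Monotone S) (z : ∀ j, EvalImage (S j))
    (hz : ∀ i j (h : i ≤ j), evalRestrict (hS h) (z j) = z i) :
    ∃ x, ∀ j, evalMap (S j) x = z j := by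
  have hcl : ∀ j, IsClosed (evalMap (S j) ⁻¹' {z j}) := fun j =>
    isClosed_singleton.preimage (continuous_evalMap _)
  -- The fibres over the points `z j` are nonempty, closed and directed downwards, by compatibility.
  obtain ⟨x, hx⟩ := IsCompact.nonempty_iInter_of_directed_nonempty_isCompact_isClosed
    (fun j => evalMap (S j) ⁻¹' {z j})
    (directed_of_isDirected_le fun i j h x (hx : evalMap (S j) x = z j) => by
      rw [Set.mem_preimage, Set.mem_singleton_iff, ← hz i j h, ← hx]; rfl)
    (fun j => (surjective_evalMap (S j)) (z j)) (fun j => (hcl j).isCompact) hcl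
  exact ⟨x, Set.mem_iInter.1 hx⟩

/-- Reduces skeletality of the bonding maps to that of the evaluation maps on `X`. -/
theorem IsSkeletal.of_comp {Y Z : Type*} [TopologicalSpace Y] [TopologicalSpace Z] {f : X → Y}
    {g : Y → Z} (h : IsSkeletal (g ∘ f)) (hf : Continuous f) (hsurj : Function.Surjective f) :
    IsSkeletal g := by
  intro U hU hne
  have := h (f ⁻¹' U) (hU.preimage hf) (hne.preimage hsurj)
  rwa [Set.image_comp, Set.image_preimage_eq U hsurj] at this

end Evaluation

/-! ### Skeletality of evaluation from the FNS property -/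

section FNS

variable {X : Type*} [TopologicalSpace X] {B : Set (Set X)}

/-- The basic open set determined by a member of `B` (ignoring the interval) or by a continuous
function together with an open interval. -/
def basicOpen : B ⊕ C(X, ℝ) → ℚ × ℚ → Set X
  | .inl U, _ => U
  | .inr f, q => f ⁻¹' Set.Ioo (q.1 : ℝ) q.2

/-- The finite intersection of basic open sets. -/
def basicInter (A : Finset (B ⊕ C(X, ℝ))) (r : A → ℚ × ℚ) : Set X :=
  ⋂ t : A, basicOpen t.1 (r t)

theorem isOpen_basicInter (hB : IsPiBase B) (A : Finset (B ⊕ C(X, ℝ))) (r : A → ℚ × ℚ) :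
    IsOpen (basicInter A r) := by
  refine isOpen_iInter_of_finite fun t => ?_
  rcases t with ⟨U | f, ht⟩
  · exact (hB.1 U U.2).1
  · exact isOpen_Ioo.preimage f.continuous

/-- The closure properties of a set `C` of members of `B` and continuous functions which make
evaluation at the functions of `C` skeletal. -/
structure IsSkeletalFamily (s : B → Finset B) (C : Set (B ⊕ C(X, ℝ))) : Prop where
  mem_of_mem : ∀ U, .inl U ∈ C → ∀ W ∈ s U, .inl W ∈ C
  exists_fun : ∀ U : B, .inl U ∈ C → ∃ f : C(X, ℝ), .inr f ∈ C ∧ (∃ x, f x ≠ 0) ∧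
    ∀ x, f x ≠ 0 → x ∈ (U : Set X)
  exists_subset : ∀ (A : Finset (B ⊕ C(X, ℝ))) (r : A → ℚ × ℚ), (A : Set (B ⊕ C(X, ℝ))) ⊆ C →
    (basicInter A r).Nonempty → ∃ U : B, .inl U ∈ C ∧ (U : Set X) ⊆ basicInter A r

theorem exists_bump [CompactSpace X] [T2Space X] (hB : IsPiBase B) (U : B) :
    ∃ f : C(X, ℝ), (∃ x, f x ≠ 0) ∧ ∀ x, f x ≠ 0 → x ∈ (U : Set X) := by
  obtain ⟨hU, x, hx⟩ := hB.1 U U.2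
  obtain ⟨f, hf0, hf1, -⟩ := exists_continuous_zero_one_of_isClosed hU.isClosed_compl
    (isClosed_singleton (x := x)) (by simpa using hx)
  refine ⟨f, ⟨x, by simp [hf1 rfl]⟩, fun y hy => ?_⟩
  by_contra h
  exact hy (hf0 h)

theorem exists_closure_operation [CompactSpace X] [T2Space X] (hB : IsPiBase B)
    (s : B → Finset B) :
    ∃ Φ : Finset (B ⊕ C(X, ℝ)) → Set (B ⊕ C(X, ℝ)), (∀ A, (Φ A).Countable) ∧
      ∀ C, IsClosedUnder Φ C → IsSkeletalFamily s C := by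
  have hpick : ∀ V : Set X, ∃ P : Set B, P.Countable ∧
      (IsOpen V → V.Nonempty → ∃ U ∈ P, (U : Set X) ⊆ V) := by
    intro V
    by_cases h : IsOpen V ∧ V.Nonempty
    · obtain ⟨U, hU, hUV⟩ := hB.2 V h.1 h.2
      exact ⟨{⟨U, hU⟩}, Set.countable_singleton _, fun _ _ => ⟨_, rfl, hUV⟩⟩
    · exact ⟨∅, Set.countable_empty, fun h₁ h₂ => (h ⟨h₁, h₂⟩).elim⟩
  choose pick hpick_countable hpick using hpick
  choose g hg using exists_bump (B := B) hB
  let Ψ : B ⊕ C(X, ℝ) → Set (B ⊕ C(X, ℝ)) :=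
    Sum.elim (fun U => insert (.inr (g U)) (Sum.inl '' (s U : Set B))) fun _ => ∅
  have hΨ : ∀ t, (Ψ t).Countable := by
    rintro (U | f)
    · exact ((s U).countable_toSet.image _).insert _
    · exact Set.countable_empty
  refine ⟨fun A => (⋃ t ∈ A, Ψ t) ∪ ⋃ r : A → ℚ × ℚ, Sum.inl '' pick (basicInter A r),
    fun A => (A.countable_toSet.biUnion fun t _ => hΨ t).union
      (Set.countable_iUnion fun r => (hpick_countable _).image _), fun C hC => ?_⟩
  have hΨC : ∀ t ∈ C, Ψ t ⊆ C := fun t ht u hu =>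
    hC {t} (by simpa using ht) (.inl (by simpa using hu))
  refine ⟨fun U hU W hW => hΨC _ hU (.inr ⟨W, hW, rfl⟩),
    fun U hU => ⟨g U, hΨC _ hU (.inl rfl), hg U⟩, fun A r hA hne => ?_⟩
  obtain ⟨U, hU, hUV⟩ := hpick _ (isOpen_basicInter hB A r) hne
  exact ⟨U, hC A hA (.inr (Set.mem_iUnion.2 ⟨r, U, hU, rfl⟩)), hUV⟩

/-- Every neighbourhood of a point of an evaluation image contains the image of a finite
intersection of preimages of rational intervals containing a given preimage of the point. -/
theorem exists_basicInter_subset {C : Set (B ⊕ C(X, ℝ))} {N : Set (EvalImage (Sum.inr ⁻¹' C))}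
    (hN : IsOpen N) {x : X} (hx : evalMap (Sum.inr ⁻¹' C) x ∈ N) {W : B} (hW : .inl W ∈ C)
    (hxW : x ∈ (W : Set X)) :
    ∃ (A : Finset (B ⊕ C(X, ℝ))) (r : A → ℚ × ℚ), (A : Set (B ⊕ C(X, ℝ))) ⊆ C ∧
      x ∈ basicInter A r ∧ basicInter A r ⊆ W ∩ evalMap (Sum.inr ⁻¹' C) ⁻¹' N := by
  classical
  obtain ⟨O, hO, rfl⟩ := isOpen_induced_iff.1 hN
  obtain ⟨I, u, hu, hbox⟩ := isOpen_pi_iff.1 hO _ hx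
  have hq : ∀ f : (Sum.inr ⁻¹' C : Set C(X, ℝ)), ∃ q : ℚ × ℚ, f.1 x ∈ Set.Ioo (q.1 : ℝ) q.2 ∧
      (f ∈ I → Set.Ioo (q.1 : ℝ) q.2 ⊆ u f) := by
    intro f
    have key : ∀ V : Set ℝ, IsOpen V → f.1 x ∈ V →
        ∃ q : ℚ × ℚ, f.1 x ∈ Set.Ioo (q.1 : ℝ) q.2 ∧ Set.Ioo (q.1 : ℝ) q.2 ⊆ V := by
      intro V hV hxV
      obtain ⟨_, hv, hxv, hvV⟩ :=
        Real.isTopologicalBasis_Ioo_rat.exists_subset_of_mem_open hxV hV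
      simp only [Set.mem_iUnion, Set.mem_singleton_iff] at hv
      obtain ⟨a, b, _, rfl⟩ := hv
      exact ⟨(a, b), hxv, hvV⟩
    by_cases hf : f ∈ I
    · obtain ⟨q, hxq, hqV⟩ := key (u f) (hu f hf).1 (hu f hf).2
      exact ⟨q, hxq, fun _ => hqV⟩
    · obtain ⟨q, hxq, -⟩ := key Set.univ isOpen_univ trivial
      exact ⟨q, hxq, fun h => (hf h).elim⟩
  choose q hxq hqu using hq
  -- Including `W` itself keeps the intersection inside `W`.
  let A : Finset (B ⊕ C(X, ℝ)) := insert (.inl W) (I.image fun f => .inr f.1)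
  have hAC : (A : Set (B ⊕ C(X, ℝ))) ⊆ C := by
    intro t ht
    simp only [A, Finset.coe_insert, Finset.coe_image, Set.mem_insert_iff, Set.mem_image] at ht
    rcases ht with rfl | ⟨f, -, rfl⟩
    exacts [hW, f.2]
  let r : A → ℚ × ℚ := fun t => match t with
    | ⟨.inl _, _⟩ => 0
    | ⟨.inr f, hf⟩ => q ⟨f, hAC hf⟩
  refine ⟨A, r, hAC, Set.mem_iInter.2 ?_, fun y hy => ⟨?_, hbox fun f hf => ?_⟩⟩
  · rintro ⟨U | f, ht⟩
    · have : U = W := by simpa [A] using ht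
      exact this ▸ hxW
    · exact hxq ⟨f, hAC ht⟩
  · exact Set.mem_iInter.1 hy ⟨.inl W, Finset.mem_insert_self _ _⟩
  · exact hqu f hf (Set.mem_iInter.1 hy
      ⟨.inr f.1, Finset.mem_insert_of_mem (Finset.mem_image_of_mem _ hf)⟩)

theorem IsSkeletalFamily.isSkeletal_evalMap (hB : IsPiBase B) {s : B → Finset B}
    (hs : ∀ U V : B, Disjoint (U : Set X) (V : Set X) →
      ∃ WU WV : B, (WU ∈ s U ∧ WU ∈ s V) ∧ (WV ∈ s U ∧ WV ∈ s V) ∧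
        Disjoint (WU : Set X) (WV : Set X) ∧ (U : Set X) ⊆ WU ∧ (V : Set X) ⊆ WV)
    {C : Set (B ⊕ C(X, ℝ))} (hC : IsSkeletalFamily s C) :
    IsSkeletal (evalMap (Sum.inr ⁻¹' C)) := by
  classical
  intro V' hV' hne
  obtain ⟨V, hVB, hVV'⟩ := hB.2 V' hV' hne
  lift V to B using hVB
  -- `A` consists of members of `B` only, so the intervals chosen for it below are irrelevant.
  let A : Finset (B ⊕ C(X, ℝ)) :=
    ((s V).filter fun W : B => .inl W ∈ C ∧ (V : Set X) ⊆ W).image Sum.inl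
  have hA : ∀ t, t ∈ A ↔ ∃ W ∈ s V, (.inl W ∈ C ∧ (V : Set X) ⊆ W) ∧ .inl W = t := by
    intro t
    simp only [A, Finset.mem_image, Finset.mem_filter, and_assoc]
  obtain ⟨W, hWC, hWA⟩ : ∃ W : B, .inl W ∈ C ∧ (W : Set X) ⊆ basicInter A fun _ => 0 := by
    refine hC.exists_subset A _ (fun t ht => ?_) ((hB.1 V V.2).2.mono ?_)
    · obtain ⟨W, -, hW, rfl⟩ := (hA t).1 ht
      exact hW.1
    · refine Set.subset_iInter ?_
      rintro ⟨t, ht⟩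
      obtain ⟨W, -, hW, rfl⟩ := (hA t).1 ht
      exact hW.2
  obtain ⟨g, hgC, ⟨x₀, hx₀⟩, hgW⟩ := hC.exists_fun W hWC
  -- If `U` missed `V`, then `WV ∈ s U` would lie in `C` and contain `V`, hence belong to `A`; so `U
  -- ⊆ W ⊆ WV`, although the nonempty `U` lies in `WU`, disjoint from `WV`.
  have hmeet : ∀ U : B, .inl U ∈ C → (U : Set X) ⊆ W → ((U : Set X) ∩ V).Nonempty := by
    intro U hU hUW
    rw [← Set.not_disjoint_iff_nonempty_inter]
    intro hdisj
    obtain ⟨WU, WV, -, hWV, hd, hUWU, hVWV⟩ := hs U V hdisj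
    obtain ⟨x, hx⟩ := (hB.1 U U.2).2
    have hxWV : x ∈ (WV : Set X) := Set.mem_iInter.1 (hWA (hUW hx))
      ⟨.inl WV, (hA _).2 ⟨WV, hWV.2, ⟨hC.mem_of_mem U hU WV hWV.1, hVWV⟩, rfl⟩⟩
    exact Set.disjoint_left.1 hd (hUWU hx) hxWV
  let G : Set (EvalImage (Sum.inr ⁻¹' C)) := {y | y.1 ⟨g, hgC⟩ ≠ 0}
  have hG : IsOpen G := isOpen_ne.preimage
    ((continuous_apply (⟨g, hgC⟩ : (Sum.inr ⁻¹' C : Set C(X, ℝ)))).comp continuous_subtype_val)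
  refine ⟨evalMap _ x₀, mem_interior.2 ⟨G, fun y hy => ?_, hG, hx₀⟩⟩
  -- A neighbourhood `N` of a point of `G` pulls back to a set containing some `U ∈ C` with `U ⊆ W`,
  -- and `U` meets `V`.
  refine mem_closure_iff.2 fun N hN hyN => ?_
  obtain ⟨x, rfl⟩ := surjective_evalMap _ y
  obtain ⟨A', r, hA'C, hxA', hA'N⟩ := exists_basicInter_subset hN hyN hWC (hgW x hy)
  obtain ⟨U, hUC, hUA'⟩ := hC.exists_subset A' r hA'C ⟨x, hxA'⟩
  obtain ⟨z, hzU, hzV⟩ := hmeet U hUC fun z hz => (hA'N (hUA' hz)).1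
  exact ⟨_, (hA'N (hUA' hzU)).2, z, hVV' hzV, rfl⟩

end FNS

/-! ### The inverse system and its limits -/

section System

variable {X : Type*} [TopologicalSpace X] {B : Type*}
  {Φ : Finset (B ⊕ C(X, ℝ)) → Set (B ⊕ C(X, ℝ))}

theorem inverseSystem_evalRestrict : InverseSystem
    (F := fun C : CountableClosed Φ => EvalImage (Sum.inr ⁻¹' C.1 : Set C(X, ℝ)))
    fun _ _ h => evalRestrict (Set.preimage_mono h) where
  map_self := fun _ _ => rfl
  map_map := fun _ _ _ _ _ _ => rfl

/-- The supremum is the union, so each coordinate of a point is seen at some stage (injectivity);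
compactness lifts threads to `X` (surjectivity). -/
theorem isContinuousSystem_evalRestrict [CompactSpace X] :
    IsContinuousSystem _ (inverseSystem_evalRestrict (X := X) (Φ := Φ)) := by
  intro a ha t ht
  have : CompactSpace (EvalImage (Sum.inr ⁻¹' t.1 : Set C(X, ℝ))) := compactSpace_evalImage _
  rw [isHomeomorph_iff_continuous_bijective]
  refine ⟨Continuous.subtype_mk (continuous_pi fun n => continuous_evalRestrict _) _,
    fun y y' h => ?_, fun z => ?_⟩
  · refine Subtype.ext (funext fun f => ?_)
    obtain ⟨n, hn⟩ := Set.mem_iUnion.1 ((CountableClosed.coe_eq_iUnion_of_isLUB ha ht).subset f.2)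
    exact congr_fun (congr_arg Subtype.val (congr_fun (congr_arg Subtype.val h) n)) ⟨f.1, hn⟩
  · obtain ⟨x, hx⟩ := exists_forall_evalMap_eq
      (S := fun n => (Sum.inr ⁻¹' (a n).1 : Set C(X, ℝ)))
      (fun _ _ h => Set.preimage_mono (ha h)) z.1 z.2
    exact ⟨evalMap _ x, Subtype.ext (funext hx)⟩

theorem nonempty_homeomorph_invLimit [CompactSpace X] [T2Space X] (hΦ : ∀ A, (Φ A).Countable) :
    Nonempty (X ≃ₜ invLimit
      (F := fun C : CountableClosed Φ => EvalImage (Sum.inr ⁻¹' C.1 : Set C(X, ℝ)))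
      fun _ _ h => evalRestrict (Set.preimage_mono h)) := by
  have := CountableClosed.isDirectedOrder hΦ
  have : Nonempty (CountableClosed Φ) :=
    (CountableClosed.exists_superset hΦ Set.countable_empty).nonempty
  let e : X → invLimit
      (F := fun C : CountableClosed Φ => EvalImage (Sum.inr ⁻¹' C.1 : Set C(X, ℝ)))
      fun _ _ h => evalRestrict (Set.preimage_mono h) :=
    fun x => ⟨fun C => evalMap _ x, fun _ _ _ => rfl⟩
  have he : IsHomeomorph e := by
    rw [isHomeomorph_iff_continuous_bijective]
    refine ⟨Continuous.subtype_mk (continuous_pi fun C => continuous_evalMap _) _,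
      fun x y h => ?_, fun z => ?_⟩
    · by_contra hxy
      obtain ⟨f, hf0, hf1, -⟩ := exists_continuous_zero_one_of_isClosed
        (isClosed_singleton (x := x)) (isClosed_singleton (x := y)) (by simpa using hxy)
      -- Some index contains the Urysohn function separating `x` from `y`.
      obtain ⟨C, hC⟩ := CountableClosed.exists_superset hΦ
        (Set.countable_singleton (.inr f : B ⊕ C(X, ℝ)))
      have hfxy : f x = f y := congr_fun (congr_arg Subtype.val
        (congr_fun (congr_arg Subtype.val h) C)) ⟨f, hC rfl⟩
      rw [hf0 rfl, hf1 rfl] at hfxy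
      exact zero_ne_one hfxy
    · obtain ⟨x, hx⟩ := exists_forall_evalMap_eq
        (S := fun C : CountableClosed Φ => (Sum.inr ⁻¹' C.1 : Set C(X, ℝ)))
        (fun _ _ h => Set.preimage_mono h) z.1 z.2
      exact ⟨x, Subtype.ext (funext hx)⟩
  exact ⟨he.homeomorph⟩

end System

theorem theorem2p11 {X : Type*} [TopologicalSpace X] [CompactSpace X] [T2Space X]
    (hX : PiFNS X) : SkeletallyGenerated X := by
  obtain ⟨B, hB, s, hs⟩ := hX
  obtain ⟨Φ, hΦ, hclosed⟩ := exists_closure_operation hB s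
  refine ⟨CountableClosed Φ, inferInstance, fun C => EvalImage (Sum.inr ⁻¹' C.1), inferInstance,
    _, inverseSystem_evalRestrict,
    (CountableClosed.exists_superset hΦ Set.countable_empty).nonempty,
    CountableClosed.isDirectedOrder hΦ, CountableClosed.isSigmaComplete,
    fun C => ⟨compactSpace_evalImage _,
      metrizableSpace_evalImage (C.2.1.preimage Sum.inr_injective)⟩,
    fun C D h => ⟨continuous_evalRestrict _, surjective_evalRestrict _, ?_⟩,
    isContinuousSystem_evalRestrict, nonempty_homeomorph_invLimit hΦ⟩
  -- The bonding map after evaluation at `D` is evaluation at `C`.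
  exact IsSkeletal.of_comp (f := evalMap (Sum.inr ⁻¹' D.1))
    ((hclosed C.1 C.2.2).isSkeletal_evalMap hB hs) (continuous_evalMap _) (surjective_evalMap _)
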